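/- For $n\ge 1$ let $\mathcal P(n)$ be the set of all partitions of $\{1,\dots,n\}$ into nonempty blocks, and let $|\pi|$ denote the number of blocks of $\pi$. For a real random variable $X$ with $\mathsf E|X|^n<\infty$, the $n$-th cumulant is $$\kappa_n(X)=\sum_{\pi\in\mathcal P(n)}(-1)^{|\pi|-1}(|\pi|-1)!\prod_{B\in\pi}\mathsf E\bigl[X^{|B|}\bigr].$$ Let $C_n^{\mathrm{cen}}=\sum_{\pi}(|\pi|-1)!$, where the sum runs over those $\pi\in\mathcal P(n)$ all of whose blocks have at least two elements, and let $\rho_{\mathrm{cen}}>0$ be the unique positive solution of $e^{\rho}=2+\rho$. Corollary 8.4 (Tail bound from the centered refinement). One has $C_n^{\mathrm{cen}}\sim (n-1)!/\rho_{\mathrm{cen}}^{\,n}$ as $n\to\infty$. Moreover, there is an absolute constant $A_{\mathrm{cen}}\ge 1$ (depending only on the sequence $(C_n^{\mathrm{cen}})_n$) such that the following holds for every real random variable $X$ with $\mathsf E[X]=0$ and finite variance $\mathsf{Var}[X]=v>0$. (a) For every $n\ge 2$ with $\mathsf E|X|^n<\infty$, $\;|\kappa_n(X)|\le C_n^{\mathrm{cen}}\,\mathsf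 E|X|^n$. (b) Suppose that there is $L>0$ such that $\mathsf E|X|^n<\infty$ and $\mathsf E|X|^n\le v\,L^{n-2}$ for all $n\ge 2$. Put $$v'=\frac{A_{\mathrm{cen}}\,v}{\rho_{\mathrm{cen}}^2},\qquad b=\frac{L}{\rho_{\mathrm{cen}}}.$$ Then $$|\kappa_n(X)|\le (n-1)!\,v'\,b^{\,n-2}\quad\text{for all } n\ge 2,$$ and $$\mathsf P(|X|\ge x)\le 2\exp\Bigl(-\frac{x^2}{2(v'+bx)}\Bigr)\quad\text{for all } x>0.$$ -/

import Mathlib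

open MeasureTheory ProbabilityTheory Filter

namespace CumulantBounds

/-- The `n`-th cumulant of `X` (for `n ≥ 1` and `E|X|^n < ∞`), given by the moment-cumulant formula:
the sum over all set partitions `π` of an `n`-element set of
`(-1)^(|π|-1) (|π|-1)! ∏_{B ∈ π} E[X^|B|]`. -/
noncomputable def cumulant {Ω : Type*} [MeasurableSpace Ω] (X : Ω → ℝ) (n : ℕ) (μ : Measure Ω) : ℝ :=
  ∑ π : Finpartition (Finset.univ : Finset (Fin n)),
    (-1 : ℝ) ^ (π.parts.card - 1) * ((π.parts.card - 1).factorial : ℝ) *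
      ∏ B ∈ π.parts, moment X B.card μ

/-- The centered refinement coefficient (for `n ≥ 1`): the sum of `(|π|-1)!` over all set
partitions `π` of an `n`-element set in which every block has at least two elements. -/
def Ccen (n : ℕ) : ℕ :=
  ∑ π : Finpartition (Finset.univ : Finset (Fin n)) with ∀ B ∈ π.parts, 2 ≤ B.card,
    (π.parts.card - 1).factorial

/-- The equation `e^ρ = 2 + ρ` has exactly one positive solution. -/
theorem existsUnique_rhoCen : ∃! ρ : ℝ, 0 < ρ ∧ Real.exp ρ = 2 + ρ := by
  have hmono : StrictMonoOn (fun x : ℝ => Real.exp x - x) (Set.Ici 0) := by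
    apply strictMonoOn_of_deriv_pos (convex_Ici 0) (by fun_prop)
    intro x hx
    rw [interior_Ici] at hx
    have h : HasDerivAt (fun x : ℝ => Real.exp x - x) (Real.exp x - 1) x :=
      (Real.hasDerivAt_exp x).sub (hasDerivAt_id x)
    rw [h.deriv]
    have := Real.one_lt_exp_iff.mpr (Set.mem_Ioi.mp hx)
    linarith
  have h2 : (2 : ℝ) ≤ Real.exp 2 - 2 := by
    have := Real.quadratic_le_exp_of_nonneg (x := 2) (by norm_num)
    linarith
  obtain ⟨ρ, hρ, hρe⟩ := intermediate_value_Icc (f := fun x : ℝ => Real.exp x - x)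
    (a := 0) (b := 2) (by norm_num) (by fun_prop) ⟨by simp, h2⟩
  have hρe : Real.exp ρ - ρ = 2 := hρe
  have h0 : ρ ≠ 0 := by
    rintro rfl
    norm_num at hρe
  refine ⟨ρ, ⟨lt_of_le_of_ne hρ.1 h0.symm, by linarith⟩, ?_⟩
  rintro y ⟨hy, hye⟩
  apply hmono.injOn (Set.mem_Ici.mpr hy.le) (Set.mem_Ici.mpr hρ.1)
  change Real.exp y - y = Real.exp ρ - ρ
  linarith

/-- The unique positive solution of `e^ρ = 2 + ρ`. -/
noncomputable def rhoCen : ℝ := existsUnique_rhoCen.choose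

theorem rhoCen_pos : 0 < rhoCen := existsUnique_rhoCen.choose_spec.1.1

theorem exp_rhoCen : Real.exp rhoCen = 2 + rhoCen := existsUnique_rhoCen.choose_spec.1.2

end CumulantBounds

/-! Weighting each partition by (|π|-1)! and marking a block B leaves an ordered partition of the
complement of B. Hence u_n = (ordered partitions into blocks of size ≥ 2)/n! has generating function
1/(2 + z - e^z), and C_{n+2} = (n+1)! (u_{n+1} + u_n) (`Ccen_eq`). In the closed disc of radius ρ
the denominator vanishes only at ρ, and simply, so subtracting the pole gives u_n ρ^n → 1/(ρ(1+ρ))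
(`tendsto_renewal_mul_pow`). This yields the asymptotics of C_n, and boundedness of the ratio yields
A.

For centred X, partitions with a singleton contribute nothing to the cumulant, and Lyapunov's
inequality bounds every other product of moments by E|X|^n.

The tail bound does not pass through cumulants: C_n ≥ 1 gives 1/n! ≤ A/(2ρ^n) for n ≥ 2, so the
moment series of the mgf is dominated by a geometric one, and Chernoff's bound finishes. -/

namespace CumulantBounds

/-! ### Partitions with a marked block -/

/-- The number of ordered set partitions of `s` into blocks with at least two elements. -/
def orderedCount {α : Type*} [DecidableEq α] (s : Finset α) : ℕ :=
  ∑ π : Finpartition s with ∀ B ∈ π.parts, 2 ≤ B.card, π.parts.card.factorial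

theorem parts_erase_sup {α : Type*} [DecidableEq α] {s B : Finset α} (π : Finpartition s)
    (hB : B ∈ π.parts) : (π.parts.erase B).sup id = s \ B := by
  ext x
  simp only [Finset.mem_sup, Finset.mem_erase, id, Finset.mem_sdiff]
  constructor
  · rintro ⟨C, ⟨hne, hC⟩, hx⟩
    exact ⟨π.subset hC hx, fun hxB => hne (π.eq_of_mem_parts hC hB hx hxB)⟩
  · rintro ⟨hx, hxB⟩
    obtain ⟨C, hC, hxC⟩ := π.exists_mem hx
    exact ⟨C, ⟨fun h => hxB (h ▸ hxC), hC⟩, hxC⟩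

theorem notMem_parts_sdiff {α : Type*} [DecidableEq α] {s B : Finset α} (hB : B.Nonempty)
    (σ : Finpartition (s \ B)) : B ∉ σ.parts := by
  obtain ⟨x, hx⟩ := hB
  exact fun h => (Finset.mem_sdiff.mp (σ.subset h hx)).2 hx

/-- Deleting B is a bijection onto the admissible partitions of `s \ B`, and |π| - 1 is the number
of blocks left. -/
theorem sum_containing_block {α : Type*} [DecidableEq α] {s B : Finset α} (hBs : B ⊆ s)
    (hB : 2 ≤ B.card) :
    ∑ π : Finpartition s with (∀ C ∈ π.parts, 2 ≤ C.card) ∧ B ∈ π.parts,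
      (π.parts.card - 1).factorial = orderedCount (s \ B) := by
  have hne : B.Nonempty := Finset.card_pos.mp (by omega)
  unfold orderedCount
  refine Finset.sum_bij'
    (fun π hπ => π.ofSubset (Finset.erase_subset B π.parts)
      (parts_erase_sup π (Finset.mem_filter.mp hπ).2.2))
    (fun σ _ => σ.extend (b := B) (c := s) hne.ne_empty Finset.sdiff_disjoint
      (Finset.sdiff_union_of_subset hBs)) ?_ ?_ ?_ ?_ ?_
  · intro π hπ
    simp only [Finset.mem_filter, Finset.mem_univ, true_and] at hπ ⊢
    exact fun C hC => hπ.1 C (Finset.mem_of_mem_erase hC)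
  · intro σ hσ
    simp only [Finset.mem_filter, Finset.mem_univ, true_and] at hσ ⊢
    refine ⟨fun C hC => ?_, Finset.mem_insert_self _ _⟩
    rcases Finset.mem_insert.mp hC with rfl | hC
    · exact hB
    · exact hσ C hC
  · intro π hπ
    ext1
    exact Finset.insert_erase (Finset.mem_filter.mp hπ).2.2
  · intro σ hσ
    ext1
    exact Finset.erase_insert (notMem_parts_sdiff hne σ)
  · intro π hπ
    congr 1
    exact (Finset.card_erase_of_mem (Finset.mem_filter.mp hπ).2.2).symm

/-- Double counting of pairs (partition, distinguished block). -/
theorem sum_parts_weight {α : Type*} [DecidableEq α] (s : Finset α) (w : ℕ → ℕ) :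
    ∑ π : Finpartition s with ∀ B ∈ π.parts, 2 ≤ B.card,
      (π.parts.card - 1).factorial * ∑ B ∈ π.parts, w B.card =
    ∑ B ∈ s.powerset with 2 ≤ B.card, w B.card * orderedCount (s \ B) := by
  have h1 : ∀ π ∈ Finset.univ.filter
      (fun π : Finpartition s => ∀ B ∈ π.parts, 2 ≤ B.card),
      (π.parts.card - 1).factorial * ∑ B ∈ π.parts, w B.card =
      ∑ B ∈ s.powerset with 2 ≤ B.card,
        if B ∈ π.parts then w B.card * (π.parts.card - 1).factorial else 0 := by
    intro π hπ
    rw [← Finset.sum_filter, Finset.mul_sum]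
    refine Finset.sum_congr ?_ (fun _ _ => mul_comm _ _)
    ext B
    simp only [Finset.mem_filter, Finset.mem_univ, true_and, Finset.mem_powerset] at hπ ⊢
    exact ⟨fun h => ⟨⟨π.subset h, hπ B h⟩, h⟩, fun h => h.2⟩
  rw [Finset.sum_congr rfl h1, Finset.sum_comm]
  refine Finset.sum_congr rfl fun B hB => ?_
  simp only [Finset.mem_filter, Finset.mem_powerset] at hB
  rw [← sum_containing_block hB.1 hB.2, ← Finset.sum_filter, Finset.filter_filter,
    Finset.mul_sum]

theorem orderedCount_empty {α : Type*} [DecidableEq α] : orderedCount (∅ : Finset α) = 1 := by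
  unfold orderedCount
  rw [Finset.sum_filter]
  have : Unique (Finpartition (∅ : Finset α)) :=
    inferInstanceAs (Unique (Finpartition (⊥ : Finset α)))
  have h : ∀ π : Finpartition (∅ : Finset α), π.parts = ∅ := fun π =>
    π.parts_eq_empty_iff.mpr rfl
  simp [h]

theorem card_parts_pos {α : Type*} [DecidableEq α] {s : Finset α} (hs : s.Nonempty)
    (π : Finpartition s) : 0 < π.parts.card :=
  Finset.card_pos.mpr (π.parts_nonempty hs.ne_empty)

/-- Weight 1 per block turns (|π|-1)! into |π|!; the marked block plays the role of the first one.
-/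
theorem orderedCount_eq {α : Type*} [DecidableEq α] {s : Finset α} (hs : s.Nonempty) :
    orderedCount s = ∑ B ∈ s.powerset with 2 ≤ B.card, orderedCount (s \ B) := by
  have h := sum_parts_weight s (fun _ => 1)
  simp only [one_mul] at h
  rw [← h]
  refine Finset.sum_congr rfl fun π _ => ?_
  rw [Finset.sum_const, smul_eq_mul, mul_one, mul_comm,
    Nat.mul_factorial_pred (card_parts_pos hs π).ne']

/-- With weight |B|, the block sizes add up to n. -/
theorem mul_Ccen (n : ℕ) :
    n * Ccen n = ∑ B ∈ (Finset.univ : Finset (Fin n)).powerset with 2 ≤ B.card,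
      B.card * orderedCount ((Finset.univ : Finset (Fin n)) \ B) := by
  rw [← sum_parts_weight _ (fun k => k), Ccen, Finset.mul_sum]
  refine Finset.sum_congr (by ext; simp) fun π _ => ?_
  rw [π.sum_card_parts, Finset.card_univ, Fintype.card_fin, mul_comm]

/-! ### The renewal sequence and its relation to `Ccen` -/

/-- The normalised number of ordered set partitions into blocks with at least two elements: the
coefficients of `1 / (2 + z - exp z)`. -/
noncomputable def renewal : ℕ → ℝ
  | 0 => 1
  | m + 1 => ∑ k : Fin m, renewal k / ((m + 1 - k : ℕ).factorial : ℝ)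
decreasing_by omega

theorem renewal_zero : renewal 0 = 1 := by rw [renewal]

theorem renewal_succ (m : ℕ) :
    renewal (m + 1) = ∑ k ∈ Finset.range m, renewal k / ((m + 1 - k : ℕ).factorial : ℝ) := by
  rw [renewal, Finset.sum_range (fun k => renewal k / ((m + 1 - k : ℕ).factorial : ℝ))]

/-- The index k is the size of the complement of B, so |B| ≥ 2 means k < m. -/
theorem sum_powerset_two_le {α : Type*} [DecidableEq α] (s : Finset α) (f : ℕ → ℝ) (m : ℕ)
    (hs : s.card = m + 1) :
    ∑ B ∈ s.powerset with 2 ≤ B.card, f B.card =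
      ∑ k ∈ Finset.range m, ((m + 1).choose k : ℝ) * f (m + 1 - k) := by
  rw [Finset.sum_filter, Finset.sum_powerset_apply_card (fun j => if 2 ≤ j then f j else 0), hs,
    ← Finset.sum_range_reflect, Finset.sum_range_succ, Finset.sum_range_succ]
  rw [if_neg (by omega), if_neg (by omega), smul_zero, smul_zero, add_zero, add_zero]
  refine Finset.sum_congr rfl fun k hk => ?_
  have hk := Finset.mem_range.mp hk
  have e : m + 1 + 1 - 1 - k = m + 1 - k := by omega
  rw [e, if_pos (by omega), Nat.choose_symm (by omega), nsmul_eq_mul]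

theorem choose_mul_factorial {n k : ℕ} (hk : k ≤ n) :
    (n.choose k : ℝ) * (k.factorial : ℝ) = (n.factorial : ℝ) / ((n - k).factorial : ℝ) := by
  rw [eq_div_iff (by positivity)]
  exact_mod_cast Nat.choose_mul_factorial_mul_factorial hk

theorem orderedCount_eq_renewal {α : Type*} [DecidableEq α] (s : Finset α) :
    (orderedCount s : ℝ) = (s.card.factorial : ℝ) * renewal s.card := by
  induction s using Finset.strongInduction with
  | H s ih =>
    rcases s.eq_empty_or_nonempty with rfl | hs
    · simp [orderedCount_empty, renewal_zero]
    obtain ⟨m, hm⟩ : ∃ m, s.card = m + 1 := ⟨s.card - 1, by have := hs.card_pos; omega⟩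
    rw [orderedCount_eq hs, Nat.cast_sum]
    have h1 : ∀ B ∈ s.powerset.filter (fun B => 2 ≤ B.card), (orderedCount (s \ B) : ℝ) =
        ((m + 1 - B.card).factorial : ℝ) * renewal (m + 1 - B.card) := by
      intro B hB
      simp only [Finset.mem_filter, Finset.mem_powerset] at hB
      rw [ih _ (Finset.sdiff_ssubset hB.1 (Finset.card_pos.mp (by omega))),
        Finset.card_sdiff_of_subset hB.1, hm]
    rw [Finset.sum_congr rfl h1, sum_powerset_two_le s
      (fun j => ((m + 1 - j).factorial : ℝ) * renewal (m + 1 - j)) m hm, hm, renewal_succ,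
      Finset.mul_sum]
    refine Finset.sum_congr rfl fun k hk => ?_
    have hk := Finset.mem_range.mp hk
    rw [show m + 1 - (m + 1 - k) = k by omega, ← mul_assoc, choose_mul_factorial (by omega)]
    ring

/-- Coefficient form of (-log(2 + z - e^z))' = (1 + z)/(2 + z - e^z) - 1. -/
theorem Ccen_eq (n : ℕ) :
    (Ccen (n + 2) : ℝ) = ((n + 1).factorial : ℝ) * (renewal (n + 1) + renewal n) := by
  have h := congrArg (Nat.cast : ℕ → ℝ) (mul_Ccen (n + 2))
  have h1 : ∀ B ∈ (Finset.univ : Finset (Fin (n + 2))).powerset.filter (fun B => 2 ≤ B.card),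
      ((B.card * orderedCount (Finset.univ \ B) : ℕ) : ℝ) =
        (B.card : ℝ) * (((n + 2 - B.card).factorial : ℝ) * renewal (n + 2 - B.card)) := by
    intro B hB
    simp only [Finset.mem_filter, Finset.mem_powerset] at hB
    rw [Nat.cast_mul, orderedCount_eq_renewal, Finset.card_sdiff_of_subset hB.1,
      Finset.card_univ, Fintype.card_fin]
  rw [Nat.cast_sum, Finset.sum_congr rfl h1, sum_powerset_two_le _
      (fun j => (j : ℝ) * (((n + 2 - j).factorial : ℝ) * renewal (n + 2 - j))) (n + 1) (by simp),
      Nat.cast_mul] at h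
  have hn : ((n + 2 : ℕ) : ℝ) ≠ 0 := by positivity
  apply mul_left_cancel₀ hn
  rw [h, ← mul_assoc, ← Nat.cast_mul, ← Nat.factorial_succ, Finset.sum_range_succ, mul_add]
  -- The weight |B| = n+2-k lowers |B|! to (n+1-k)!. The terms k < n then form the recursion for
  -- `renewal (n + 1)`, and k = n leaves `renewal n`.
  have key : ∀ k ≤ n, (((n + 1 + 1).choose k : ℕ) : ℝ) * (((n + 1 + 1 - k : ℕ) : ℝ) *
      (((n + 2 - (n + 1 + 1 - k)).factorial : ℝ) * renewal (n + 2 - (n + 1 + 1 - k)))) =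
      ((n + 1 + 1).factorial : ℝ) * (renewal k / ((n + 1 - k).factorial : ℝ)) := by
    intro k hk
    rw [show n + 2 - (n + 1 + 1 - k) = k by omega]
    have e := choose_mul_factorial (n := n + 1 + 1) (k := k) (by omega)
    have e2 : (n + 1 + 1 - k) = (n + 1 - k) + 1 := by omega
    rw [e2, Nat.factorial_succ (n + 1 - k), Nat.cast_mul] at e
    have hp : (((n + 1 - k + 1 : ℕ)) : ℝ) ≠ 0 := by positivity
    have hq : (((n + 1 - k).factorial : ℕ) : ℝ) ≠ 0 := by positivity
    rw [e2]
    field_simp at e ⊢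
    linear_combination renewal k * e
  rw [key n le_rfl, Finset.sum_congr rfl fun k hk => key k (Finset.mem_range.mp hk).le,
    ← Finset.mul_sum, renewal_succ]
  simp

/-- The one-block partition contributes 0! = 1. -/
theorem one_le_Ccen {n : ℕ} (hn : 2 ≤ n) : 1 ≤ Ccen n := by
  have hne : (Finset.univ : Finset (Fin n)) ≠ ⊥ :=
    (Finset.univ_nonempty_iff.mpr ⟨⟨0, by omega⟩⟩).ne_empty
  unfold Ccen
  refine le_trans ?_ (Finset.single_le_sum
    (f := fun π : Finpartition (Finset.univ : Finset (Fin n)) => (π.parts.card - 1).factorial)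
    (fun _ _ => Nat.zero_le _)
    (Finset.mem_filter.mpr ⟨Finset.mem_univ (Finpartition.indiscrete hne), ?_⟩))
  · exact Nat.succ_le_of_lt (Nat.factorial_pos _)
  · intro B hB
    have : B = Finset.univ := by simpa using hB
    simpa [this] using hn

/-! ### Singularity analysis of 1/(2 + z - e^z) -/

open Metric Topology

/-- If a power series sums on a small disc to a function holomorphic on a disc of radius `R`, its
coefficients are `o(r⁻ⁿ)` for every `r < R`. -/
theorem tendsto_coeff_mul_pow {a : ℕ → ℂ} {Q : ℂ → ℂ} {δ r R : ℝ} (hδ : 0 < δ) (hr : 0 ≤ r)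
    (hrR : r < R) (hQ : DifferentiableOn ℂ Q (ball 0 R))
    (h : ∀ z : ℂ, ‖z‖ < δ → HasSum (fun n => a n * z ^ n) (Q z)) :
    Tendsto (fun n => a n * (r : ℂ) ^ n) atTop (𝓝 0) := by
  have hsum : ∀ z ∈ ball (0 : ℂ) R,
      HasSum (fun n : ℕ => ((n.factorial : ℂ)⁻¹ * iteratedDeriv n Q 0) * z ^ n) (Q z) := by
    intro z hz
    have := Complex.hasSum_taylorSeries_on_ball hQ hz
    refine this.congr_fun ?_
    intro n
    simp only [sub_zero, smul_eq_mul]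
    ring
  have hps : ∀ (b : ℕ → ℂ) (ε : ℝ), 0 < ε →
      (∀ z ∈ ball (0 : ℂ) ε, HasSum (fun n => b n * z ^ n) (Q z)) →
      HasFPowerSeriesAt Q (FormalMultilinearSeries.ofScalars ℂ b) 0 := by
    intro b ε hε hb
    rw [hasFPowerSeriesAt_iff]
    filter_upwards [ball_mem_nhds (0 : ℂ) hε] with z hz
    simpa [mul_comm] using hb z hz
  -- Uniqueness of power series at 0 identifies `a` with the Taylor coefficients, whose series
  -- converges on the larger disc.
  have heq := (hps a δ hδ fun z hz => h z (by simpa using hz)).eq_formalMultilinearSeries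
    (hps _ R (hr.trans_lt hrR) hsum)
  have hcoeff : a = fun n : ℕ => ((n.factorial : ℂ)⁻¹ * iteratedDeriv n Q 0) :=
    FormalMultilinearSeries.ofScalars_series_injective ℂ ℂ heq
  have hr' : (r : ℂ) ∈ ball (0 : ℂ) R := by simpa [abs_of_nonneg hr] using hrR
  have := (hsum r hr').summable.tendsto_atTop_zero
  rw [hcoeff]
  exact this

theorem rhoCen_lt : rhoCen < 3 / 2 := by
  by_contra! h
  have h1 := exp_rhoCen
  have h2 := Real.sum_le_exp_of_nonneg rhoCen_pos.le 4
  simp [Finset.sum_range_succ, Nat.factorial] at h2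
  nlinarith [pow_le_pow_left₀ (by norm_num) h 2]

/-- For x ≥ 0, compare with e^ρ = e^x e^(ρ-x) > e^x (1 + ρ - x). For x < 0, e^x (1 - x) ≤ 1, and e^x
≥ 2 + x would force x² + x ≥ 1, impossible for -3/2 < x < 0. -/
theorem exp_lt_two_add {x : ℝ} (h1 : -rhoCen ≤ x) (h2 : x < rhoCen) : Real.exp x < 2 + x := by
  rcases le_or_gt 0 x with hx | hx
  · have hρ := exp_rhoCen
    have h3 := Real.add_one_lt_exp (x := rhoCen - x) (by linarith)
    have h4 : Real.exp rhoCen = Real.exp x * Real.exp (rhoCen - x) := by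
      rw [← Real.exp_add]; congr 1; ring
    have h5 : 1 ≤ Real.exp x := Real.one_le_exp hx
    nlinarith
  · have h3 := Real.add_one_le_exp (-x)
    have h4 : Real.exp x * Real.exp (-x) = 1 := by rw [← Real.exp_add]; simp
    have h5 := rhoCen_lt
    have h6 := Real.exp_pos x
    by_contra! h
    nlinarith [mul_le_mul h h3 (by linarith) h6.le]

/-- On the closed disc of radius `ρ`, the only zero of `2 + z - exp z` is `ρ`. -/
theorem eq_rhoCen_of_exp_eq {z : ℂ} (hz : ‖z‖ ≤ rhoCen) (h : Complex.exp z = 2 + z) :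
    z = rhoCen := by
  have hre := abs_le.mp ((Complex.abs_re_le_norm z).trans hz)
  have h1 : Real.exp z.re = ‖2 + z‖ := by rw [← h, Complex.norm_exp]
  have h2 : 2 + z.re ≤ ‖2 + z‖ := by
    have := Complex.re_le_norm (2 + z)
    simpa using this
  -- Otherwise e^(Re z) < 2 + Re z ≤ |2 + z| = e^(Re z).
  have h3 : z.re = rhoCen := by
    by_contra hne
    have := exp_lt_two_add hre.1 (lt_of_le_of_ne hre.2 hne)
    linarith
  have h4 : z.im = 0 := by
    have h5 := Complex.sq_norm z
    rw [Complex.normSq_apply, h3] at h5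
    have : ‖z‖ ^ 2 ≤ rhoCen ^ 2 := by gcongr
    nlinarith
  exact Complex.ext (by simpa using h3) (by simpa using h4)

theorem renewal_nonneg (n : ℕ) : 0 ≤ renewal n := by
  induction n using Nat.strong_induction_on with
  | _ n ih =>
    cases n with
    | zero => rw [renewal_zero]; norm_num
    | succ m =>
      rw [renewal_succ]
      exact Finset.sum_nonneg fun k hk =>
        div_nonneg (ih k (by have := Finset.mem_range.mp hk; omega)) (Nat.cast_nonneg _)

/-- The sequence u_n ρ^n obeys a recursion with weights ρ^j/j!, j ≥ 2, whose total mass is e^ρ - 1 -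
ρ = 1. -/
theorem renewal_mul_pow_le (n : ℕ) : renewal n * rhoCen ^ n ≤ 1 := by
  induction n using Nat.strong_induction_on with
  | _ n ih =>
    cases n with
    | zero => simp [renewal_zero]
    | succ m =>
      have hρ := rhoCen_pos
      calc renewal (m + 1) * rhoCen ^ (m + 1)
          = ∑ k ∈ Finset.range m, (renewal k * rhoCen ^ k) *
              (rhoCen ^ (m + 1 - k) / ((m + 1 - k).factorial : ℝ)) := by
            rw [renewal_succ, Finset.sum_mul]
            refine Finset.sum_congr rfl fun k hk => ?_
            have hk := Finset.mem_range.mp hk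
            have : rhoCen ^ (m + 1) = rhoCen ^ k * rhoCen ^ (m + 1 - k) := by
              rw [← pow_add]; congr 1; omega
            rw [this]; ring
        _ ≤ ∑ k ∈ Finset.range m, rhoCen ^ (m + 1 - k) / ((m + 1 - k).factorial : ℝ) := by
            refine Finset.sum_le_sum fun k hk => ?_
            have hk := Finset.mem_range.mp hk
            exact mul_le_of_le_one_left (by positivity) (ih k (by omega))
        _ = (∑ j ∈ Finset.range (m + 2), rhoCen ^ j / (j.factorial : ℝ)) - 1 - rhoCen := by
            rw [← Finset.sum_range_reflect _ (m + 2), Finset.sum_range_succ, Finset.sum_range_succ]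
            have e1 : m + 2 - 1 - (m + 1) = 0 := by omega
            have e2 : m + 2 - 1 - m = 1 := by omega
            have e3 : ∀ k, m + 2 - 1 - k = m + 1 - k := fun k => by omega
            rw [e1, e2]
            simp only [e3]
            simp
        _ ≤ Real.exp rhoCen - 1 - rhoCen := by
            have := Real.sum_le_exp_of_nonneg hρ.le (m + 2)
            linarith
        _ = 1 := by rw [exp_rhoCen]; ring

theorem sum_antidiagonal_renewal (n : ℕ) :
    ∑ k ∈ Finset.range (n + 2), renewal k / ((n + 1 - k).factorial : ℝ) =
      2 * renewal (n + 1) + renewal n := by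
  rw [Finset.sum_range_succ, Finset.sum_range_succ, ← renewal_succ]
  simp
  ring

theorem summable_norm_renewal {z : ℂ} (hz : ‖z‖ < rhoCen) :
    Summable fun n => ‖(renewal n : ℂ) * z ^ n‖ := by
  have hρ := rhoCen_pos
  refine Summable.of_nonneg_of_le (fun _ => norm_nonneg _) (fun n => ?_)
    (summable_geometric_of_lt_one (r := ‖z‖ / rhoCen) (by positivity) ((div_lt_one hρ).mpr hz))
  rw [norm_mul, norm_pow, Complex.norm_real, Real.norm_of_nonneg (renewal_nonneg n), div_pow,
    le_div_iff₀ (by positivity)]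
  nlinarith [renewal_mul_pow_le n, pow_nonneg (norm_nonneg z) n]

/-- The generating function of `renewal` is `1 / (2 + z - exp z)`. -/
theorem tsum_renewal_mul {z : ℂ} (hz : ‖z‖ < rhoCen) :
    (∑' n, (renewal n : ℂ) * z ^ n) * (2 + z - Complex.exp z) = 1 := by
  have hs := summable_norm_renewal hz
  have he : Summable fun n : ℕ => ‖z ^ n / (n.factorial : ℂ)‖ :=
    NormedSpace.norm_expSeries_div_summable z
  have hexp : Complex.exp z = ∑' n : ℕ, z ^ n / (n.factorial : ℂ) := by
    rw [Complex.exp_eq_exp_ℂ, NormedSpace.exp_eq_tsum_div]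
  set U := ∑' n, (renewal n : ℂ) * z ^ n with hU
  have hprod := tsum_mul_tsum_eq_tsum_sum_range_of_summable_norm hs he
  have hUs : HasSum (fun n => (renewal n : ℂ) * z ^ n) U := hs.of_norm.hasSum
  have hU1 : HasSum (fun n => (renewal (n + 1) : ℂ) * z ^ (n + 1)) (U - 1) := by
    have := (hasSum_nat_add_iff' 1).mpr hUs
    simpa [renewal_zero] using this
  have hlhs : HasSum (fun n => ∑ k ∈ Finset.range (n + 1),
      ((renewal k : ℂ) * z ^ k) * (z ^ (n - k) / ((n - k).factorial : ℂ)))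
      (2 * (U - 1) + z * U + 1) := by
    -- The convolution identity holds only in degree ≥ 1, so the constant term is split off.
    rw [← hasSum_nat_add_iff' 1]
    have h2 := (hU1.mul_left 2).add (hUs.mul_left z)
    have e0 : (2 * (U - 1) + z * U + 1) - ∑ i ∈ Finset.range 1, ∑ k ∈ Finset.range (i + 1),
      ((renewal k : ℂ) * z ^ k) * (z ^ (i - k) / ((i - k).factorial : ℂ)) =
      2 * (U - 1) + z * U := by simp [renewal_zero]
    rw [e0]
    refine h2.congr_fun fun n => ?_
    have e1 : ∀ k ∈ Finset.range (n + 1 + 1),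
        ((renewal k : ℂ) * z ^ k) * (z ^ (n + 1 - k) / ((n + 1 - k).factorial : ℂ)) =
        ((renewal k / ((n + 1 - k).factorial : ℝ) : ℝ) : ℂ) * z ^ (n + 1) := by
      intro k hk
      have hk := Finset.mem_range.mp hk
      have : z ^ (n + 1) = z ^ k * z ^ (n + 1 - k) := by
        rw [← pow_add]; congr 1; omega
      rw [this]; push_cast; ring
    rw [Finset.sum_congr rfl e1, ← Finset.sum_mul, ← Complex.ofReal_sum,
      sum_antidiagonal_renewal]
    push_cast
    ring
  rw [mul_sub, hexp, hprod, hlhs.tsum_eq]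
  ring

/-- The entire function `(2 + z - exp z) / (z - ρ)`. -/
noncomputable def phi : ℂ → ℂ := dslope (fun z : ℂ => 2 + z - Complex.exp z) rhoCen

theorem differentiable_dslope {f : ℂ → ℂ} (hf : Differentiable ℂ f) (c : ℂ) :
    Differentiable ℂ (dslope f c) :=
  differentiableOn_univ.mp
    ((Complex.differentiableOn_dslope univ_mem).mpr hf.differentiableOn)

theorem differentiable_phi : Differentiable ℂ phi :=
  differentiable_dslope (by fun_prop) _

theorem cexp_rhoCen : Complex.exp rhoCen = 2 + rhoCen := by
  rw [← Complex.ofReal_exp, exp_rhoCen]; push_cast; ring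

theorem sub_mul_phi (z : ℂ) : (z - rhoCen) * phi z = 2 + z - Complex.exp z := by
  have := sub_smul_dslope (fun z : ℂ => 2 + z - Complex.exp z) rhoCen z
  simp only [smul_eq_mul, cexp_rhoCen] at this
  rw [phi, this]; ring

/-- The value is the derivative 1 - e^ρ; being nonzero, it makes the zero at ρ simple. -/
theorem phi_rhoCen : phi rhoCen = -(1 + rhoCen) := by
  rw [phi, dslope_same]
  have : HasDerivAt (fun z : ℂ => 2 + z - Complex.exp z) (1 - Complex.exp rhoCen) rhoCen :=
    ((hasDerivAt_id _).const_add 2).sub (Complex.hasDerivAt_exp _)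
  rw [this.deriv, cexp_rhoCen]; ring

theorem one_add_rhoCen_ne_zero : (1 + rhoCen : ℂ) ≠ 0 := by
  have : (0 : ℝ) < 1 + rhoCen := by linarith [rhoCen_pos]
  exact_mod_cast this.ne'

theorem phi_ne_zero {z : ℂ} (hz : ‖z‖ ≤ rhoCen) : phi z ≠ 0 := by
  intro h
  have h1 := sub_mul_phi z
  rw [h, mul_zero] at h1
  have h2 := eq_rhoCen_of_exp_eq hz (by linear_combination h1)
  rw [h2, phi_rhoCen] at h
  exact one_add_rhoCen_ne_zero (neg_eq_zero.mp h)

/-- By compactness, an open set containing the closed disc contains a larger disc. -/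
theorem exists_ball_phi_ne_zero : ∃ R > rhoCen, ∀ z ∈ ball (0 : ℂ) R, phi z ≠ 0 := by
  have hopen : IsOpen {z : ℂ | phi z ≠ 0} :=
    isOpen_ne_fun differentiable_phi.continuous continuous_const
  obtain ⟨δ, hδ, h⟩ := (isCompact_closedBall (0 : ℂ) rhoCen).exists_thickening_subset_open hopen
    (fun z hz => phi_ne_zero (by simpa using hz))
  refine ⟨δ + rhoCen, by linarith, fun z hz => h ?_⟩
  rw [thickening_closedBall hδ rhoCen_pos.le]
  exact hz

theorem tendsto_renewal_mul_pow :
    Tendsto (fun n => renewal n * rhoCen ^ n) atTop (𝓝 (1 / (rhoCen * (1 + rhoCen)))) := by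
  have hρ := rhoCen_pos
  have hρ0 : (rhoCen : ℂ) ≠ 0 := by exact_mod_cast hρ.ne'
  have hρ1 := one_add_rhoCen_ne_zero
  obtain ⟨R, hR, hne⟩ := exists_ball_phi_ne_zero
  set c : ℂ := 1 / (rhoCen * (1 + rhoCen)) with hc
  -- This quotient is 1/((z-ρ)φ(z)) minus its polar part c/(1 - z/ρ), since φ(ρ) = -(1+ρ).
  have hQ : DifferentiableOn ℂ (fun z => dslope phi rhoCen z / (phi z * (1 + rhoCen)))
      (ball 0 R) := by
    intro z hz
    refine DifferentiableAt.differentiableWithinAt ?_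
    exact (differentiable_dslope differentiable_phi _ z).div
      ((differentiable_phi z).mul_const _) (mul_ne_zero (hne z hz) hρ1)
  have key := tendsto_coeff_mul_pow (a := fun n => (renewal n : ℂ) - c / (rhoCen : ℂ) ^ n)
    hρ hρ.le hR hQ (by
      intro z hz
      have h1 : HasSum (fun n => (renewal n : ℂ) * z ^ n) _ :=
        (summable_norm_renewal hz).of_norm.hasSum
      have h2 := tsum_renewal_mul hz
      rw [← sub_mul_phi] at h2
      have hnorm : ‖z / rhoCen‖ < 1 := by
        rw [norm_div, Complex.norm_real, Real.norm_of_nonneg hρ.le]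
        exact (div_lt_one hρ).mpr hz
      have h3 := (hasSum_geometric_of_norm_lt_one hnorm).mul_left c
      have hzρ : z - rhoCen ≠ 0 := left_ne_zero_of_mul (right_ne_zero_of_mul_eq_one h2)
      have hφ := phi_ne_zero hz.le
      have h4 := sub_smul_dslope phi rhoCen z
      rw [smul_eq_mul, phi_rhoCen] at h4
      have hz' : (1 - z / rhoCen : ℂ) ≠ 0 := by
        intro h
        apply hzρ
        field_simp at h
        linear_combination -h
      have e1 : (1 - z / rhoCen : ℂ)⁻¹ = -rhoCen / (z - rhoCen) := by
        rw [inv_eq_iff_eq_inv, inv_div]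
        field_simp
        ring
      have hval : dslope phi rhoCen z / (phi z * (1 + rhoCen)) =
          (∑' n, (renewal n : ℂ) * z ^ n) - c * (1 - z / rhoCen : ℂ)⁻¹ := by
        rw [eq_div_of_mul_eq (right_ne_zero_of_mul_eq_one h2) h2, e1,
          eq_div_of_mul_eq hzρ ((mul_comm _ _).trans h4), hc]
        field_simp
        ring
      rw [hval]
      refine (h1.sub h3).congr_fun fun n => ?_
      rw [div_pow]
      ring)
  have key2 : Tendsto (fun n => (renewal n : ℂ) * (rhoCen : ℂ) ^ n) atTop (𝓝 c) := by
    have := key.add_const c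
    rw [zero_add] at this
    refine this.congr fun n => ?_
    field_simp
    ring
  have key3 := (Complex.continuous_re.tendsto c).comp key2
  have hcr : c = ((1 / (rhoCen * (1 + rhoCen)) : ℝ) : ℂ) := by rw [hc]; push_cast; rfl
  rw [hcr, Complex.ofReal_re] at key3
  refine key3.congr fun n => ?_
  simp only [Function.comp]
  rw [← Complex.ofReal_pow, ← Complex.ofReal_mul, Complex.ofReal_re]

/-- By `Ccen_eq` the limit is (ρ + ρ²)/(ρ(1+ρ)) = 1. -/
theorem tendsto_Ccen :
    Tendsto (fun n => (Ccen n : ℝ) * rhoCen ^ n / ((n - 1).factorial : ℝ)) atTop (𝓝 1) := by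
  have hρ := rhoCen_pos
  rw [← tendsto_add_atTop_iff_nat 2]
  have h1 := ((tendsto_add_atTop_iff_nat 1).mpr tendsto_renewal_mul_pow).const_mul rhoCen
  have h2 := tendsto_renewal_mul_pow.const_mul (rhoCen ^ 2)
  have h3 := h1.add h2
  have e : rhoCen * (1 / (rhoCen * (1 + rhoCen))) + rhoCen ^ 2 * (1 / (rhoCen * (1 + rhoCen))) =
      1 := by field_simp
  rw [e] at h3
  refine h3.congr fun n => ?_
  rw [Ccen_eq, show n + 2 - 1 = n + 1 by omega]
  field_simp
  ring

theorem isEquivalent_Ccen :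
    Asymptotics.IsEquivalent atTop (fun n : ℕ => (Ccen n : ℝ))
      (fun n : ℕ => ((n - 1).factorial : ℝ) / rhoCen ^ n) := by
  have hρ := rhoCen_pos
  refine Asymptotics.isEquivalent_of_tendsto_one ?_
  refine tendsto_Ccen.congr fun n => ?_
  simp only [Pi.div_apply]
  field_simp

theorem exists_Ccen_le : ∃ A : ℝ, 1 ≤ A ∧
    ∀ n, (Ccen n : ℝ) ≤ A * (((n - 1).factorial : ℝ) / rhoCen ^ n) := by
  obtain ⟨M, hM⟩ := tendsto_Ccen.bddAbove_range
  refine ⟨max 1 M, le_max_left _ _, fun n => ?_⟩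
  have hρ := rhoCen_pos
  have h : (Ccen n : ℝ) * rhoCen ^ n / ((n - 1).factorial : ℝ) ≤ max 1 M :=
    (hM ⟨n, rfl⟩).trans (le_max_right _ _)
  rw [div_le_iff₀ (by positivity)] at h
  rw [← mul_div_assoc, le_div_iff₀ (by positivity)]
  exact h

/-! ### Absolute moments and cumulants -/

variable {Ω : Type*} [MeasurableSpace Ω] {μ : Measure Ω} {X : Ω → ℝ}

theorem integrable_abs_pow_of_le [IsFiniteMeasure μ] (hX : AEStronglyMeasurable X μ) {k n : ℕ}
    (hkn : k ≤ n) (hn : Integrable (fun ω => |X ω| ^ n) μ) :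
    Integrable (fun ω => |X ω| ^ k) μ := by
  refine ((integrable_const (1 : ℝ)).add hn).mono' (hX.norm.pow k) (ae_of_all _ fun ω => ?_)
  rw [Real.norm_of_nonneg (by positivity)]
  simp only [Pi.add_apply]
  rcases le_total |X ω| 1 with h | h
  · have := pow_le_one₀ (abs_nonneg (X ω)) h (n := k)
    have : 0 ≤ |X ω| ^ n := by positivity
    linarith
  · have := pow_le_pow_right₀ h hkn
    linarith

theorem integrable_pow_of_abs (hX : AEStronglyMeasurable X μ) {k : ℕ}
    (hk : Integrable (fun ω => |X ω| ^ k) μ) : Integrable (fun ω => X ω ^ k) μ :=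
  hk.mono' (hX.pow k) (ae_of_all _ fun ω => by rw [Real.norm_eq_abs, abs_pow])

/-- Lyapunov's inequality for absolute moments. -/
theorem integral_abs_pow_le [IsProbabilityMeasure μ] (hX : AEStronglyMeasurable X μ) {k n : ℕ}
    (hk : 0 < k) (hkn : k ≤ n) (hn : Integrable (fun ω => |X ω| ^ n) μ) :
    ∫ ω, |X ω| ^ k ∂μ ≤ (∫ ω, |X ω| ^ n ∂μ) ^ ((k : ℝ) / n) := by
  have hk' : (0 : ℝ) < k := by exact_mod_cast hk
  have hn' : (0 : ℝ) < n := by exact_mod_cast hk.trans_le hkn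
  have hp : (1 : ℝ) ≤ (n : ℝ) / k := by
    rw [le_div_iff₀ hk', one_mul]; exact_mod_cast hkn
  have hcomp : ((fun x : ℝ => x ^ ((n : ℝ) / k)) ∘ fun ω => |X ω| ^ k) = fun ω => |X ω| ^ n := by
    funext ω
    simp only [Function.comp]
    rw [← Real.rpow_natCast, ← Real.rpow_mul (abs_nonneg _), mul_div_cancel₀ _ hk'.ne',
      Real.rpow_natCast]
  -- Jensen's inequality for y ↦ y^(n/k) applied to |X|^k.
  have hj := (convexOn_rpow hp).map_integral_le (μ := μ) (f := fun ω => |X ω| ^ k)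
    (Real.continuous_rpow_const (by positivity)).continuousOn isClosed_Ici
    (ae_of_all _ fun ω => Set.mem_Ici.mpr (by positivity)) (integrable_abs_pow_of_le hX hkn hn)
    (by rw [hcomp]; exact hn)
  have hj' : (∫ ω, |X ω| ^ k ∂μ) ^ ((n : ℝ) / k) ≤ ∫ ω, |X ω| ^ n ∂μ :=
    hj.trans_eq (congrArg (fun f => ∫ ω, f ω ∂μ) hcomp)
  have h0 : 0 ≤ ∫ ω, |X ω| ^ k ∂μ := integral_nonneg fun ω => by positivity
  calc ∫ ω, |X ω| ^ k ∂μ = ((∫ ω, |X ω| ^ k ∂μ) ^ ((n : ℝ) / k)) ^ ((k : ℝ) / n) := by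
        rw [← Real.rpow_mul h0, div_mul_div_cancel₀ hk'.ne', div_self hn'.ne', Real.rpow_one]
    _ ≤ _ := by gcongr

theorem abs_moment_le (k : ℕ) : |moment X k μ| ≤ ∫ ω, |X ω| ^ k ∂μ := by
  rw [moment_def]
  refine (abs_integral_le_integral_abs).trans_eq ?_
  simp only [Pi.pow_apply, abs_pow]

/-- Lyapunov bounds each factor by a power of E|X|^n, and the exponents |B|/n sum to 1. -/
theorem prod_abs_moment_le [IsProbabilityMeasure μ] (hX : AEStronglyMeasurable X μ) {n : ℕ}
    (hn0 : 0 < n) (hn : Integrable (fun ω => |X ω| ^ n) μ)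
    (π : Finpartition (Finset.univ : Finset (Fin n))) :
    ∏ B ∈ π.parts, |moment X B.card μ| ≤ ∫ ω, |X ω| ^ n ∂μ := by
  set M := ∫ ω, |X ω| ^ n ∂μ with hM
  have hM0 : 0 ≤ M := integral_nonneg fun ω => by positivity
  have hn' : (0 : ℝ) < n := by exact_mod_cast hn0
  calc ∏ B ∈ π.parts, |moment X B.card μ|
      ≤ ∏ B ∈ π.parts, M ^ ((B.card : ℝ) / n) := by
        refine Finset.prod_le_prod (fun _ _ => abs_nonneg _) fun B hB => ?_
        exact (abs_moment_le _).trans (integral_abs_pow_le hX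
          (Finset.card_pos.mpr (π.nonempty_of_mem_parts hB))
          (by simpa using Finset.card_le_univ B) hn)
    _ = M ^ (∑ B ∈ π.parts, (B.card : ℝ) / n) :=
        (Real.rpow_sum_of_nonneg hM0 fun B _ => by positivity).symm
    _ = M := by
        rw [← Finset.sum_div, ← Nat.cast_sum, π.sum_card_parts, Finset.card_univ,
          Fintype.card_fin, div_self hn'.ne', Real.rpow_one]

/-- For centred `X`, partitions with a singleton block do not contribute to the cumulant. -/
theorem abs_cumulant_le [IsProbabilityMeasure μ] (hX : AEStronglyMeasurable X μ)
    (hX0 : ∫ ω, X ω ∂μ = 0) {n : ℕ} (hn0 : 0 < n) (hn : Integrable (fun ω => |X ω| ^ n) μ) :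
    |cumulant X n μ| ≤ (Ccen n : ℝ) * ∫ ω, |X ω| ^ n ∂μ := by
  unfold cumulant Ccen
  rw [Nat.cast_sum, Finset.sum_mul, Finset.sum_filter]
  refine (Finset.abs_sum_le_sum_abs _ _).trans (Finset.sum_le_sum fun π _ => ?_)
  split_ifs with h
  · rw [abs_mul, abs_mul, abs_pow, abs_neg, abs_one, one_pow, one_mul, Nat.abs_cast,
      Finset.abs_prod]
    exact mul_le_mul_of_nonneg_left (prod_abs_moment_le hX hn0 hn π) (Nat.cast_nonneg _)
  · push Not at h
    obtain ⟨B, hB, hB2⟩ := h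
    have hB1 : B.card = 1 := by
      have := Finset.card_pos.mpr (π.nonempty_of_mem_parts hB)
      omega
    have : moment X B.card μ = 0 := by
      rw [hB1, moment_def, pow_one]; exact hX0
    rw [Finset.prod_eq_zero hB this, mul_zero, abs_zero]

/-! ### Exponential moments and the tail bound -/

/-- A summable bound on the exponential moment series controls the moment generating function. -/
theorem mgf_le_of_moment_bounds [IsProbabilityMeasure μ] (hX : AEStronglyMeasurable X μ)
    (hX0 : ∫ ω, X ω ∂μ = 0) (hint : ∀ n : ℕ, 2 ≤ n → Integrable (fun ω => |X ω| ^ n) μ)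
    {t S : ℝ} {c : ℕ → ℝ} (hc : HasSum c S)
    (hb : ∀ n, |t| ^ (n + 2) / ((n + 2).factorial : ℝ) * ∫ ω, |X ω| ^ (n + 2) ∂μ ≤ c n) :
    Integrable (fun ω => Real.exp (t * X ω)) μ ∧ mgf X μ t ≤ 1 + S := by
  set F : ℕ → Ω → ℝ := fun n ω => (t * X ω) ^ n / (n.factorial : ℝ) with hF
  have habs : ∀ n, Integrable (fun ω => |X ω| ^ n) μ := fun n =>
    integrable_abs_pow_of_le hX (by omega) (hint (n + 2) (by omega))
  have hFi : ∀ n, Integrable (F n) μ := fun n => by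
    simp only [hF, mul_pow]
    exact ((integrable_pow_of_abs hX (habs n)).const_mul _).div_const _
  have hFn : ∀ n, ∫ ω, ‖F n ω‖ ∂μ = |t| ^ n / (n.factorial : ℝ) * ∫ ω, |X ω| ^ n ∂μ := fun n => by
    rw [← integral_const_mul]
    refine integral_congr_ae (ae_of_all _ fun ω => ?_)
    simp only [hF, norm_div, norm_pow, norm_mul, Real.norm_eq_abs, mul_pow, Nat.abs_cast]
    ring
  have hsum : Summable fun n => ∫ ω, ‖F n ω‖ ∂μ := by
    rw [← summable_nat_add_iff 2]
    refine Summable.of_nonneg_of_le (fun n => integral_nonneg fun ω => norm_nonneg _)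
      (fun n => ?_) hc.summable
    rw [hFn]
    exact hb n
  have hexp : ∀ ω, HasSum (fun n => F n ω) (Real.exp (t * X ω)) := fun ω => by
    rw [Real.exp_eq_exp_ℝ]
    exact NormedSpace.expSeries_div_hasSum_exp (t * X ω)
  have hI := hasSum_integral_of_summable_integral_norm hFi hsum
  have htsum : (fun ω => ∑' n, F n ω) = fun ω => Real.exp (t * X ω) :=
    funext fun ω => (hexp ω).tsum_eq
  rw [htsum] at hI
  constructor
  · refine ⟨Real.continuous_exp.comp_aestronglyMeasurable (hX.const_mul t), ?_⟩
    rw [hasFiniteIntegral_iff_enorm]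
    calc ∫⁻ ω, ‖Real.exp (t * X ω)‖ₑ ∂μ ≤ ∫⁻ ω, ∑' n, ‖F n ω‖ₑ ∂μ := by
          refine lintegral_mono fun ω => ?_
          rw [← (hexp ω).tsum_eq]
          exact enorm_tsum_le_tsum_enorm
      _ = ∑' n, ∫⁻ ω, ‖F n ω‖ₑ ∂μ := lintegral_tsum fun n => (hFi n).1.enorm
      _ = ∑' n, ENNReal.ofReal (∫ ω, ‖F n ω‖ ∂μ) := by
          congr 1
          funext n
          exact (ofReal_integral_norm_eq_lintegral_enorm (hFi n)).symm
      _ < ⊤ := hsum.tsum_ofReal_lt_top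
  · rw [mgf]
    -- The degree 0 term is 1 and centring kills degree 1, so only n ≥ 2 needs a bound.
    have hI2 := (hasSum_nat_add_iff' 2).mpr hI
    have h0 : ∫ ω, F 0 ω ∂μ = 1 := by simp [hF]
    have h1 : ∫ ω, F 1 ω ∂μ = 0 := by simp [hF, integral_const_mul, hX0]
    rw [Finset.sum_range_succ, Finset.sum_range_one, h0, h1, add_zero] at hI2
    have := hasSum_le (fun n => ?_) hI2 hc
    · linarith
    · refine le_trans ?_ (hb n)
      rw [← hFn]
      exact (Real.le_norm_self _).trans (norm_integral_le_integral_norm _)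

theorem mgf_le_exp_of_abs_moment_le [IsProbabilityMeasure μ] (hX : AEStronglyMeasurable X μ)
    (hX0 : ∫ ω, X ω ∂μ = 0) {A v L t : ℝ}
    (hA : ∀ n : ℕ, (Ccen n : ℝ) ≤ A * (((n - 1).factorial : ℝ) / rhoCen ^ n))
    (hv : 0 < v) (hL : 0 < L)
    (h : ∀ n : ℕ, 2 ≤ n → Integrable (fun ω => |X ω| ^ n) μ ∧
      ∫ ω, |X ω| ^ n ∂μ ≤ v * L ^ (n - 2))
    (ht : L / rhoCen * |t| < 1) :
    Integrable (fun ω => Real.exp (t * X ω)) μ ∧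
      mgf X μ t ≤ Real.exp (A * v / rhoCen ^ 2 * t ^ 2 / (2 * (1 - L / rhoCen * |t|))) := by
  have hρ := rhoCen_pos
  have hr0 : 0 ≤ L / rhoCen * |t| := by positivity
  have hgeo := (hasSum_geometric_of_lt_one hr0 ht).mul_left (A * v / rhoCen ^ 2 * t ^ 2 / 2)
  -- From 1 ≤ C_{n+2} ≤ A (n+1)!/ρ^(n+2) and (n+2)! ≥ 2 (n+1)!.
  have hfact : ∀ n : ℕ, 1 / ((n + 2).factorial : ℝ) ≤ A / (2 * rhoCen ^ (n + 2)) := by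
    intro n
    have h1 : (1 : ℝ) ≤ A * (((n + 1).factorial : ℝ) / rhoCen ^ (n + 2)) :=
      le_trans (by exact_mod_cast one_le_Ccen (n := n + 2) (by omega)) (hA (n + 2))
    have hAp : 0 < A := by
      by_contra! hA0
      have : A * (((n + 1).factorial : ℝ) / rhoCen ^ (n + 2)) ≤ 0 :=
        mul_nonpos_of_nonpos_of_nonneg hA0 (by positivity)
      linarith
    have e : ((n + 2).factorial : ℝ) = ((n : ℝ) + 2) * ((n + 1).factorial : ℝ) := by
      rw [Nat.factorial_succ (n + 1)]; push_cast; ring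
    rw [← mul_div_assoc, le_div_iff₀ (by positivity), one_mul] at h1
    rw [div_le_div_iff₀ (by positivity) (by positivity), e, one_mul]
    have : 0 ≤ (n : ℝ) * (A * ((n + 1).factorial : ℝ)) := by positivity
    nlinarith
  obtain ⟨hi, hm⟩ := mgf_le_of_moment_bounds hX hX0 (fun n hn => (h n hn).1)
    (t := t) hgeo (by
    intro n
    have h2 := (h (n + 2) (by omega)).2
    rw [Nat.add_sub_cancel] at h2
    calc |t| ^ (n + 2) / ((n + 2).factorial : ℝ) * ∫ ω, |X ω| ^ (n + 2) ∂μ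
        = |t| ^ (n + 2) * (1 / ((n + 2).factorial : ℝ)) * ∫ ω, |X ω| ^ (n + 2) ∂μ := by ring
      _ ≤ |t| ^ (n + 2) * (1 / ((n + 2).factorial : ℝ)) * (v * L ^ n) := by gcongr
      _ ≤ |t| ^ (n + 2) * (A / (2 * rhoCen ^ (n + 2))) * (v * L ^ n) :=
          mul_le_mul_of_nonneg_right (mul_le_mul_of_nonneg_left (hfact n) (by positivity))
            (by positivity)
      _ = A * v / rhoCen ^ 2 * t ^ 2 / 2 * (L / rhoCen * |t|) ^ n := by
          rw [mul_pow, div_pow, pow_add, pow_add, sq_abs]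
          field_simp)
  refine ⟨hi, hm.trans ?_⟩
  rw [add_comm]
  refine (Real.add_one_le_exp _).trans_eq (congrArg Real.exp ?_)
  have : 1 - L / rhoCen * |t| ≠ 0 := by linarith
  field_simp

/-- Bernstein's inequality from a Bernstein-type bound on the moment generating function. -/
theorem measure_ge_le_of_mgf_le [IsFiniteMeasure μ] {w b x : ℝ} (hw : 0 < w) (hb : 0 < b)
    (hx : 0 < x)
    (h : ∀ t, 0 ≤ t → b * t < 1 → Integrable (fun ω => Real.exp (t * X ω)) μ ∧
      mgf X μ t ≤ Real.exp (w * t ^ 2 / (2 * (1 - b * t)))) :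
    μ.real {ω | x ≤ X ω} ≤ Real.exp (-(x ^ 2 / (2 * (w + b * x)))) := by
  have hd : 0 < w + b * x := by positivity
  -- The Chernoff parameter t = x/(w+bx) makes 1 - bt = w/(w+bx), so the mgf exponent is tx/2, half
  -- of the gain tx.
  have ht : 0 ≤ x / (w + b * x) := by positivity
  have e : 1 - b * (x / (w + b * x)) = w / (w + b * x) := by field_simp; ring
  have hbt : b * (x / (w + b * x)) < 1 := by
    have : 0 < w / (w + b * x) := by positivity
    linarith
  obtain ⟨hi, hm⟩ := h _ ht hbt
  refine (measure_ge_le_exp_mul_mgf x ht hi).trans ?_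
  refine (mul_le_mul_of_nonneg_left hm (Real.exp_pos _).le).trans_eq ?_
  rw [← Real.exp_add, e]
  congr 1
  field_simp
  ring

theorem measure_abs_ge_le [IsProbabilityMeasure μ] (hX : MemLp X 2 μ)
    (hX0 : ∫ ω, X ω ∂μ = 0) {A v L x : ℝ} (hA1 : 1 ≤ A)
    (hA : ∀ n : ℕ, (Ccen n : ℝ) ≤ A * (((n - 1).factorial : ℝ) / rhoCen ^ n))
    (hv : 0 < v) (hL : 0 < L)
    (h : ∀ n : ℕ, 2 ≤ n → Integrable (fun ω => |X ω| ^ n) μ ∧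
      ∫ ω, |X ω| ^ n ∂μ ≤ v * L ^ (n - 2)) (hx : 0 < x) :
    μ.real {ω | x ≤ |X ω|} ≤
      2 * Real.exp (-(x ^ 2 / (2 * (A * v / rhoCen ^ 2 + (L / rhoCen) * x)))) := by
  have hρ := rhoCen_pos
  have hw : 0 < A * v / rhoCen ^ 2 := by positivity
  have hb : 0 < L / rhoCen := by positivity
  have h1 := measure_ge_le_of_mgf_le hw hb hx fun t ht hbt => by
    have := mgf_le_exp_of_abs_moment_le hX.1 hX0 hA hv hL h (t := t)
      (by rwa [abs_of_nonneg ht])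
    rwa [abs_of_nonneg ht] at this
  have h2 := measure_ge_le_of_mgf_le (X := fun ω => -X ω) hw hb hx fun t ht hbt => by
    have := mgf_le_exp_of_abs_moment_le (X := fun ω => -X ω) hX.1.neg
      (by rw [integral_neg, hX0, neg_zero]) hA hv hL (by simpa only [abs_neg] using h) (t := t)
      (by rwa [abs_of_nonneg ht])
    rwa [abs_of_nonneg ht] at this
  have hset : {ω | x ≤ |X ω|} = {ω | x ≤ X ω} ∪ {ω | x ≤ -X ω} := by
    ext ω
    exact le_abs (a := x) (b := X ω)
  rw [hset]
  refine (measureReal_union_le _ _).trans ?_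
  linarith

end CumulantBounds

theorem corollary8p4 :
    Asymptotics.IsEquivalent atTop (fun n : ℕ => (CumulantBounds.Ccen n : ℝ))
      (fun n : ℕ => ((n - 1).factorial : ℝ) / CumulantBounds.rhoCen ^ n) ∧
    ∃ A : ℝ, 1 ≤ A ∧
      ∀ (Ω : Type*) [MeasurableSpace Ω] (μ : Measure Ω) [IsProbabilityMeasure μ]
        (X : Ω → ℝ) (v : ℝ),
        MemLp X 2 μ → ∫ ω, X ω ∂μ = 0 → variance X μ = v → 0 < v →
        (∀ n : ℕ, 2 ≤ n → Integrable (fun ω => |X ω| ^ n) μ →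
          |CumulantBounds.cumulant X n μ| ≤
            (CumulantBounds.Ccen n : ℝ) * ∫ ω, |X ω| ^ n ∂μ) ∧
        ∀ L : ℝ, 0 < L →
          (∀ n : ℕ, 2 ≤ n → Integrable (fun ω => |X ω| ^ n) μ ∧
            ∫ ω, |X ω| ^ n ∂μ ≤ v * L ^ (n - 2)) →
          (∀ n : ℕ, 2 ≤ n →
            |CumulantBounds.cumulant X n μ| ≤
              ((n - 1).factorial : ℝ) * (A * v / CumulantBounds.rhoCen ^ 2) *
                (L / CumulantBounds.rhoCen) ^ (n - 2)) ∧
          ∀ x : ℝ, 0 < x →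
            μ.real {ω | x ≤ |X ω|} ≤
              2 * Real.exp (-(x ^ 2 / (2 * (A * v / CumulantBounds.rhoCen ^ 2 +
                (L / CumulantBounds.rhoCen) * x)))) := by
  obtain ⟨A, hA1, hA⟩ := CumulantBounds.exists_Ccen_le
  refine ⟨CumulantBounds.isEquivalent_Ccen, A, hA1, ?_⟩
  intro Ω _ μ _ X v hX hX0 _ hv
  refine ⟨fun n hn hint => CumulantBounds.abs_cumulant_le hX.1 hX0 (by omega) hint,
    fun L hL h => ⟨fun n hn => ?_,
      fun x hx => CumulantBounds.measure_abs_ge_le hX hX0 hA1 hA hv hL h hx⟩⟩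
  have hρ := CumulantBounds.rhoCen_pos
  calc |CumulantBounds.cumulant X n μ|
      ≤ (CumulantBounds.Ccen n : ℝ) * ∫ ω, |X ω| ^ n ∂μ :=
        CumulantBounds.abs_cumulant_le hX.1 hX0 (by omega) (h n hn).1
    _ ≤ A * (((n - 1).factorial : ℝ) / CumulantBounds.rhoCen ^ n) * (v * L ^ (n - 2)) :=
        mul_le_mul (hA n) (h n hn).2 (integral_nonneg fun ω => by positivity) (by positivity)
    _ = _ := by
        obtain ⟨m, rfl⟩ := Nat.exists_eq_add_of_le' hn
        rw [Nat.add_sub_cancel, div_pow, pow_add]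
        field_simp
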